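/- Let $X$ be a Polish space and let $T : X \to X$ be an aperiodic homeomorphism, i.e. $T^n x \neq x$ for all $x \in X$ and all integers $n \geq 1$. Then there exist a compact metric space $Y$, a homeomorphism $S : Y \to Y$, a dense $G_\delta$ subset $D \subseteq Y$ with $S(D) = D$, and a homeomorphism $F : X \to D$ (where $D$ carries the subspace topology) such that $F(Tx) = S(F(x))$ for all $x \in X$; that is, $T$ is conjugate by a homeomorphism to the restriction $S|_D$. -/

import Mathlib

/-- A self-map is aperiodic if no point satisfies `T^n x = x` for some `n ≥ 1`
(`Function.periodicPts T` is the set of the points that do). -/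
def IsAperiodic {X : Type*} (T : X → X) : Prop :=
  ∀ x : X, x ∉ Function.periodicPts T

open Topology TopologicalSpace Filter unitInterval

/-! Embed `X` in the Hilbert cube `Q`. Recording whole orbits embeds `X` in the compact metrizable
space `ℤ → Q` and turns `T` into the shift. The closure of the image is shift-invariant because the
image is, and the image is `Gδ` in it because `X` is completely metrizable. -/

/-- A complete metric space embedded densely in a Hausdorff space is a `Gδ` subset of it. -/
theorem Topology.IsEmbedding.isGδ_range_of_dense {X Y : Type*} [MetricSpace X] [CompleteSpace X]
    [TopologicalSpace Y] [T2Space Y] {f : X → Y} (hf : IsEmbedding f) (hd : DenseRange f) :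
    IsGδ (Set.range f) := by
  -- Points near which `f⁻¹` oscillates by less than `1/(n+1)`; at a point of every `U n`,
  -- neighbourhoods pull back to a Cauchy filter.
  let U : ℕ → Set Y := fun n =>
    ⋃₀ {V | IsOpen V ∧ ∀ a b, f a ∈ V → f b ∈ V → dist a b < 1 / ((n : ℝ) + 1)}
  have hU : ∀ n, IsOpen (U n) := fun n => isOpen_sUnion fun V hV => hV.1
  suffices h : Set.range f = ⋂ n, U n by
    rw [h]
    exact .iInter_of_isOpen hU
  apply Set.Subset.antisymm
  · rintro _ ⟨x, rfl⟩
    refine Set.mem_iInter.2 fun n => ?_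
    have hpos : (0 : ℝ) < 1 / ((n : ℝ) + 1) / 2 := by positivity
    obtain ⟨V, hV, hVeq⟩ := hf.isOpen_iff.1
      (Metric.isOpen_ball : IsOpen (Metric.ball x (1 / ((n : ℝ) + 1) / 2)))
    have mem_iff : ∀ a, f a ∈ V ↔ dist a x < 1 / ((n : ℝ) + 1) / 2 := fun a => by
      rw [← Set.mem_preimage, hVeq, Metric.mem_ball]
    refine ⟨V, ⟨hV, fun a b ha hb => ?_⟩, (mem_iff x).2 (by simpa using hpos)⟩
    linarith [dist_triangle_right a b x, (mem_iff a).1 ha, (mem_iff b).1 hb]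
  · intro y hy
    have : NeBot (comap f (𝓝 y)) :=
      comap_neBot fun t ht => (mem_closure_iff_nhds.1 (hd y) t ht).elim
        fun _ ⟨hzt, x, hx⟩ => ⟨x, hx ▸ hzt⟩
    have hc : Cauchy (comap f (𝓝 y)) := by
      refine Metric.cauchy_iff.2 ⟨this, fun ε hε => ?_⟩
      obtain ⟨n, hn⟩ := exists_nat_one_div_lt hε
      obtain ⟨V, ⟨hV, hdist⟩, hyV⟩ := Set.mem_iInter.1 hy n
      exact ⟨f ⁻¹' V, preimage_mem_comap (hV.mem_nhds hyV),
        fun a ha b hb => (hdist a b ha hb).trans hn⟩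
    obtain ⟨x, hx⟩ := CompleteSpace.complete hc
    refine ⟨x, tendsto_nhds_unique (f := f) (l := comap f (𝓝 y)) ?_ tendsto_comap⟩
    exact (hf.continuous.tendsto x).mono_left hx

/-- The two-sided shift on the bi-infinite sequences in a topological space. -/
def shiftHomeomorph (Q : Type*) [TopologicalSpace Q] : (ℤ → Q) ≃ₜ (ℤ → Q) where
  toFun z n := z (n + 1)
  invFun z n := z (n - 1)
  left_inv z := by simp
  right_inv z := by simp

/-- The itinerary of a point `x` under `T`, read through the map `e`. -/
def itinerary {X Q : Type*} [TopologicalSpace X] (T : X ≃ₜ X) (e : X → Q) (x : X) : ℤ → Q :=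
  fun n => e ((T ^ n) x)

theorem itinerary_apply_self {X Q : Type*} [TopologicalSpace X] [TopologicalSpace Q]
    (T : X ≃ₜ X) (e : X → Q) (x : X) :
    itinerary T e (T x) = shiftHomeomorph Q (itinerary T e x) := by
  funext n
  change e ((T ^ n) (T x)) = e ((T ^ (n + 1)) x)
  rw [zpow_add_one]
  rfl

theorem Topology.IsEmbedding.itinerary {X Q : Type*} [TopologicalSpace X] [TopologicalSpace Q]
    (T : X ≃ₜ X) {e : X → Q} (he : IsEmbedding e) : IsEmbedding (itinerary T e) := by
  refine .of_comp (continuous_pi fun n => he.continuous.comp (T ^ n).continuous)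
    -- Coordinate `0` of the itinerary is `e` itself, already an embedding.
    (continuous_apply (0 : ℤ)) ?_
  exact he

/-- The range of the itinerary map is invariant under the shift in both directions. -/
theorem shiftHomeomorph_preimage_range_itinerary {X Q : Type*} [TopologicalSpace X]
    [TopologicalSpace Q] (T : X ≃ₜ X) (e : X → Q) :
    shiftHomeomorph Q ⁻¹' Set.range (itinerary T e) = Set.range (itinerary T e) := by
  ext z
  constructor
  · rintro ⟨x, hx⟩
    refine ⟨T.symm x, (shiftHomeomorph Q).injective ?_⟩
    rw [← itinerary_apply_self, T.apply_symm_apply, hx]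
  · rintro ⟨x, rfl⟩
    exact ⟨T x, itinerary_apply_self T e x⟩

theorem corollary4p6 {X : Type*} [TopologicalSpace X] [PolishSpace X] (T : X ≃ₜ X)
    (hT : IsAperiodic T) :
    ∃ (Y : Type) (_ : MetricSpace Y) (_ : CompactSpace Y) (S : Y ≃ₜ Y) (D : Set Y)
      (hD : ∀ y : Y, y ∈ D ↔ S y ∈ D),
      Dense D ∧ IsGδ D ∧
        ∃ F : X ≃ₜ D, ∀ x : X, F (T x) = (S.subtype hD : D ≃ₜ D) (F x) := by
  let := upgradeIsCompletelyMetrizable X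
  obtain ⟨e, he⟩ := Metric.PiNatEmbed.exists_embedding_to_hilbert_cube (X := X)
  have hφ := he.itinerary T
  let K : Set (ℤ → ℕ → I) := closure (Set.range (itinerary T e))
  have hK : ∀ z, z ∈ K ↔ shiftHomeomorph (ℕ → I) z ∈ K := fun z => by
    rw [← Set.mem_preimage, Homeomorph.preimage_closure, shiftHomeomorph_preimage_range_itinerary]
  let f : X → K := fun x => ⟨itinerary T e x, subset_closure ⟨x, rfl⟩⟩
  have hf : IsEmbedding f := .of_comp (hφ.continuous.subtype_mk _) continuous_subtype_val hφ
  have hd : DenseRange f := fun y => by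
    rw [closure_subtype, ← Set.range_comp]
    exact y.2
  have hfT : ∀ x, f (T x) = (shiftHomeomorph (ℕ → I)).subtype hK (f x) := fun x =>
    Subtype.ext (itinerary_apply_self T e x)
  have hD : ∀ y : K, y ∈ Set.range f ↔
      (shiftHomeomorph (ℕ → I)).subtype hK y ∈ Set.range f := fun y => by
    constructor
    · rintro ⟨x, rfl⟩
      exact ⟨T x, hfT x⟩
    · rintro ⟨x, hx⟩
      refine ⟨T.symm x, ((shiftHomeomorph (ℕ → I)).subtype hK).injective ?_⟩
      rw [← hfT, T.apply_symm_apply, hx]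
  exact ⟨K, metrizableSpaceMetric K, isCompact_iff_compactSpace.1 isClosed_closure.isCompact,
    (shiftHomeomorph (ℕ → I)).subtype hK, Set.range f, hD, hd, hf.isGδ_range_of_dense hd,
    hf.toHomeomorph, fun x => Subtype.ext (hfT x)⟩
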